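/- Let $\mathbf B=\{z=(z_j)_{j\ge 1}\in\mathbb C^{\mathbb N}:\ |z_j|<1 \text{ for all } j,\ z_j\to 0\}$ be the open unit ball of the Banach space $\mathbf c_0$ of complex null sequences (with the sup norm). Let $A^+(\mathbb T^\infty)$ be the algebra, under pointwise operations, of the functions $f(z)=\sum_{\alpha} a_\alpha z^\alpha$ on $\mathbf B$, where $\alpha$ runs over the finitely supported sequences of non-negative integers, $z^\alpha=\prod_j z_j^{\alpha_j}$, and $\|f\|:=\sum_\alpha |a_\alpha|<\infty$. Let $\phi=(\phi_j)_j:\mathbf B\to\mathbf B$ be an analytic map which induces a composition operator $C_\phi$ on $A^+(\mathbb T^\infty)$, i.e. $C_\phi f:=f\circ\phi\in A^+(\mathbb T^\infty)$ for every $f\in A^+(\mathbb T^\infty)$. If $C_\phi$ is an isometric automorphism of $A^+(\mathbb T^\infty)$ (that is, $C_\phi$ is bijective and $\|C_\phi f\|=\|f\|$ for all $f$), then there are a permutation $\sigma$ of $\mathbb N$ and complex numbers $\epsilon_j$ with $|\epsilon_j|=1$ such that $\phi(z)=(\epsilon_j z_{\sigma(j)})_{j}$ for all $z\in\mathbf B$.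 -/

import Mathlib

noncomputable section

/-- The Banach space `c₀` of complex sequences tending to zero at infinity, with the norm
`‖z‖ = sup_j |z_j|`: continuous functions vanishing at infinity on the discrete space `ℕ`. -/
abbrev CZero : Type := ZeroAtInftyContinuousMap ℕ ℂ

/-- The open unit ball `𝐁` of `c₀`. -/
def ballB : Set CZero := Metric.ball (0 : CZero) 1

theorem CZero.norm_coord_le (z : CZero) (j : ℕ) : ‖z j‖ ≤ ‖z‖ :=
  z.toBCF.norm_coe_le_norm j

theorem norm_coord_lt_one (z : ballB) (j : ℕ) : ‖z.1 j‖ < 1 :=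
  (z.1.norm_coord_le j).trans_lt (by simpa [ballB] using z.2)

/-- `𝐁 = 𝔻^∞ ∩ c₀`. -/
theorem mem_ballB_iff (z : CZero) : z ∈ ballB ↔ ∀ j, ‖z j‖ < 1 := by
  refine ⟨fun h j => norm_coord_lt_one ⟨z, h⟩ j, fun h => ?_⟩
  have h0 : Filter.Tendsto (fun j => ‖z j‖) Filter.cofinite (nhds 0) := by
    have := z.zero_at_infty'
    rw [Filter.cocompact_eq_cofinite] at this
    simpa using this.norm
  have hfin : {j | ¬ ‖z j‖ < 1 / 2}.Finite := by
    have := h0.eventually (gt_mem_nhds (show (0 : ℝ) < 1 / 2 by norm_num))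
    simpa [Filter.eventually_cofinite] using this
  obtain ⟨c, hc0, hc1, hc⟩ : ∃ c : ℝ, 0 ≤ c ∧ c < 1 ∧ ∀ j, ‖z j‖ ≤ c := by
    by_cases hne : {j | ¬ ‖z j‖ < 1 / 2}.Nonempty
    · obtain ⟨i, hi, hmax⟩ := hfin.exists_maximalFor (fun j => ‖z j‖) _ hne
      refine ⟨‖z i‖, norm_nonneg _, h i, fun j => ?_⟩
      by_cases hj : ‖z j‖ < 1 / 2
      · exact hj.le.trans (not_lt.mp hi)
      · rcases le_total ‖z j‖ ‖z i‖ with h1 | h1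
        · exact h1
        · exact hmax hj h1
    · refine ⟨1 / 2, by norm_num, by norm_num, fun j => ?_⟩
      by_contra hj
      exact hne ⟨j, fun h' => hj h'.le⟩
  have hle : ‖z.toBCF‖ ≤ c := (BoundedContinuousFunction.norm_le hc0).2 hc
  simpa [ballB] using (show ‖z‖ ≤ c from hle).trans_lt hc1

/-- The monomial `z^α = ∏_j z_j^{α_j}`, for a finitely supported multi-index `α`. -/
def monom (α : ℕ →₀ ℕ) (z : ballB) : ℂ := α.prod fun j k => z.1 j ^ k

theorem norm_monom_le (α : ℕ →₀ ℕ) (z : ballB) : ‖monom α z‖ ≤ 1 := by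
  rw [monom, Finsupp.prod, norm_prod]
  refine Finset.prod_le_one (fun _ _ => norm_nonneg _) fun j _ => ?_
  rw [norm_pow]
  exact pow_le_one₀ (norm_nonneg _) (norm_coord_lt_one z j).le

/-- `f(z) = ∑_α a_α z^α` for all `z ∈ 𝐁`, with `∑_α |a_α| < ∞`. -/
def IsExpansion (a : (ℕ →₀ ℕ) → ℂ) (f : ballB → ℂ) : Prop :=
  (Summable fun α => ‖a α‖) ∧ ∀ z, f z = ∑' α, a α * monom α z

theorem summable_norm_mul_monom {a : (ℕ →₀ ℕ) → ℂ} (ha : Summable fun α => ‖a α‖) (z : ballB) :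
    Summable fun α => ‖a α * monom α z‖ :=
  ha.of_nonneg_of_le (fun _ => norm_nonneg _) fun α => by
    rw [norm_mul]
    exact mul_le_of_le_one_right (norm_nonneg _) (norm_monom_le α z)

theorem IsExpansion.const (c : ℂ) : IsExpansion (Pi.single 0 c) fun _ => c := by
  refine ⟨summable_of_ne_finset_zero (s := {0}) fun α hα => ?_, fun z => ?_⟩
  · rw [Pi.single_eq_of_ne (by simpa using hα), norm_zero]
  · rw [tsum_eq_single 0 fun α hα => by rw [Pi.single_eq_of_ne hα, zero_mul]]
    simp [monom]

theorem IsExpansion.add {a b : (ℕ →₀ ℕ) → ℂ} {f g : ballB → ℂ} (hf : IsExpansion a f)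
    (hg : IsExpansion b g) : IsExpansion (a + b) (f + g) := by
  refine ⟨(hf.1.add hg.1).of_nonneg_of_le (fun _ => norm_nonneg _) fun α => norm_add_le _ _,
    fun z => ?_⟩
  rw [Pi.add_apply, hf.2, hg.2, ← (summable_norm_mul_monom hf.1 z).of_norm.tsum_add
    (summable_norm_mul_monom hg.1 z).of_norm]
  exact tsum_congr fun α => by rw [Pi.add_apply, add_mul]

theorem IsExpansion.mul {a b : (ℕ →₀ ℕ) → ℂ} {f g : ballB → ℂ} (hf : IsExpansion a f)
    (hg : IsExpansion b g) :
    IsExpansion (fun γ => ∑ p ∈ Finset.HasAntidiagonal.antidiagonal γ, a p.1 * b p.2) (f * g) := by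
  refine ⟨?_, fun z => ?_⟩
  · have h := summable_sum_mul_antidiagonal_of_summable_mul (f := fun α => ‖a α‖)
      (g := fun α => ‖b α‖) (hf.1.mul_of_nonneg hg.1 (fun _ => norm_nonneg _) fun _ => norm_nonneg _)
    refine h.of_nonneg_of_le (fun _ => norm_nonneg _) fun γ => ?_
    exact (norm_sum_le _ _).trans (Finset.sum_le_sum fun p _ => norm_mul_le _ _)
  · have h1 := summable_norm_mul_monom hf.1 z
    have h2 := summable_norm_mul_monom hg.1 z
    have h3 := Summable.tsum_mul_tsum_eq_tsum_sum_antidiagonal (f := fun α => a α * monom α z)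
      (g := fun α => b α * monom α z) h1.of_norm h2.of_norm
      (summable_mul_of_summable_norm (f := fun α => a α * monom α z)
        (g := fun α => b α * monom α z) h1 h2)
    rw [Pi.mul_apply, hf.2, hg.2, h3]
    refine tsum_congr fun γ => ?_
    rw [Finset.sum_mul]
    refine Finset.sum_congr rfl fun p hp => ?_
    have : monom γ z = monom p.1 z * monom p.2 z := by
      rw [← Finset.HasAntidiagonal.mem_antidiagonal.1 hp, monom, monom, monom]
      exact Finsupp.prod_add_index' (fun _ => pow_zero _) fun _ _ _ => pow_add _ _ _
    rw [this]
    ring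

/-- The coefficients of an absolutely convergent expansion are determined by the function on
`𝐁`, so that the norm defined below does not depend on any choice. -/
theorem IsExpansion.unique {a b : (ℕ →₀ ℕ) → ℂ} {f : ballB → ℂ} (ha : IsExpansion a f)
    (hb : IsExpansion b f) : a = b := by
  classical
  set c : (ℕ →₀ ℕ) → ℂ := fun α => a α - b α with hc
  have hcs : Summable fun α => ‖c α‖ :=
    (ha.1.add hb.1).of_nonneg_of_le (fun _ => norm_nonneg _) fun α => norm_sub_le _ _
  have hc0 : ∀ z : ballB, ∑' α, c α * monom α z = 0 := by
    intro z
    have h1 := (summable_norm_mul_monom ha.1 z).of_norm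
    have h2 := (summable_norm_mul_monom hb.1 z).of_norm
    calc ∑' α, c α * monom α z = ∑' α, (a α * monom α z - b α * monom α z) :=
          tsum_congr fun α => by rw [hc]; ring
      _ = 0 := by rw [h1.tsum_sub h2, ← ha.2, ← hb.2, sub_self]
  suffices h : ∀ α, c α = 0 from funext fun α => sub_eq_zero.1 (h α)
  intro α₀
  set S := α₀.support with hS
  set n₀ := α₀.sum (fun _ x => x) with hn₀
  set P : MvPolynomial ℕ ℂ :=
    ∑ α ∈ Finset.finsuppAntidiag S n₀, MvPolynomial.monomial α (c α) with hP
  suffices hP0 : P = 0 by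
    have := congrArg (MvPolynomial.coeff α₀) hP0
    rw [hP, MvPolynomial.coeff_sum, MvPolynomial.coeff_zero] at this
    simp only [MvPolynomial.coeff_monomial] at this
    rw [Finset.sum_ite_eq' , if_pos] at this
    · exact this
    · rw [Finset.mem_finsuppAntidiag']
      exact ⟨rfl, subset_rfl⟩
  refine MvPolynomial.funext fun u => ?_
  rw [map_zero]
  -- the point with coordinates `t u_j` for `j ∈ S`, and `0` elsewhere
  have hM : ∃ M : ℝ, 0 < M ∧ ∀ j ∈ S, ‖u j‖ ≤ M := by
    refine ⟨1 + ∑ j ∈ S, ‖u j‖, by positivity, fun j hj => ?_⟩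
    have := Finset.single_le_sum (f := fun j => ‖u j‖) (fun _ _ => norm_nonneg _) hj
    have h' : ‖u j‖ ≤ ∑ j ∈ S, ‖u j‖ := this
    linarith
  obtain ⟨M, hM0, hM⟩ := hM
  let pt : ℂ → CZero := fun t =>
    { toFun := fun j => if j ∈ S then t * u j else 0
      continuous_toFun := continuous_of_discreteTopology
      zero_at_infty' := by
        rw [Filter.cocompact_eq_cofinite]
        refine tendsto_const_nhds.congr' ?_
        have : ∀ᶠ j in Filter.cofinite, j ∉ S := S.finite_toSet.eventually_cofinite_notMem
        filter_upwards [this] with j hj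
        rw [if_neg hj] }
  have hpt : ∀ t : ℂ, ‖t‖ < 1 / M → pt t ∈ ballB := by
    intro t ht
    rw [mem_ballB_iff]
    intro j
    change ‖(if j ∈ S then t * u j else 0 : ℂ)‖ < 1
    split_ifs with hj
    · rw [norm_mul]
      calc ‖t‖ * ‖u j‖ ≤ ‖t‖ * M := by gcongr; exact hM j hj
        _ < 1 := by rwa [lt_div_iff₀ hM0] at ht
    · simp
  let Q : ℕ → ℂ := fun n => ∑ α ∈ Finset.finsuppAntidiag S n, c α * α.prod fun j k => u j ^ k
  have hmon : ∀ (t : ℂ) (ht : ‖t‖ < 1 / M) (α : ℕ →₀ ℕ), monom α ⟨pt t, hpt t ht⟩ =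
      if α.support ⊆ S then t ^ (α.sum fun _ x => x) * α.prod (fun j k => u j ^ k) else 0 := by
    intro t ht α
    change (α.prod fun j k => (if j ∈ S then t * u j else 0 : ℂ) ^ k) = _
    split_ifs with hα
    · simp only [Finsupp.prod, Finsupp.sum]
      rw [← Finset.prod_pow_eq_pow_sum, ← Finset.prod_mul_distrib]
      refine Finset.prod_congr rfl fun j hj => ?_
      rw [if_pos (hα hj), mul_pow]
    · obtain ⟨j, hj, hjS⟩ := Finset.not_subset.1 hα
      refine Finset.prod_eq_zero hj ?_
      simp only
      rw [if_neg hjS, zero_pow (Finsupp.mem_support_iff.1 hj)]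
  have hQ : ∀ t : ℂ, ‖t‖ < 1 / M → HasSum (fun n => t ^ n * Q n) 0 := by
    intro t ht
    have hsum := (summable_norm_mul_monom hcs ⟨pt t, hpt t ht⟩).of_norm.hasSum
    rw [hc0] at hsum
    have hsum' : HasSum (fun p : (Σ n : ℕ, {α : ℕ →₀ ℕ // (α.sum fun _ x => x) = n}) =>
        c p.2.1 * monom p.2.1 ⟨pt t, hpt t ht⟩) 0 :=
      (Equiv.sigmaFiberEquiv (fun α : ℕ →₀ ℕ => α.sum fun _ x => x)).hasSum_iff.2 hsum
    refine hsum'.sigma fun n => ?_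
    obtain ⟨G, hG1, hG0⟩ : ∃ G : (ℕ →₀ ℕ) → ℂ,
        (∀ α ∈ Finset.finsuppAntidiag S n, G α = t ^ n * (c α * α.prod fun j k => u j ^ k)) ∧
        ∀ α ∉ Finset.finsuppAntidiag S n, G α = 0 :=
      ⟨fun α => if α ∈ Finset.finsuppAntidiag S n then
          t ^ n * (c α * α.prod fun j k => u j ^ k) else 0,
        fun α hα => if_pos hα, fun α hα => if_neg hα⟩
    have hval : ∀ p : {α : ℕ →₀ ℕ // (α.sum fun _ x => x) = n},
        c p.1 * monom p.1 ⟨pt t, hpt t ht⟩ = G p.1 := by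
      rintro ⟨α, hα⟩
      change c α * monom α ⟨pt t, hpt t ht⟩ = G α
      rw [hmon t ht α]
      by_cases hs : α.support ⊆ S
      · rw [if_pos hs, hG1 α (Finset.mem_finsuppAntidiag'.2 ⟨hα, hs⟩), hα]
        ring
      · rw [if_neg hs, hG0 α (fun h => hs (Finset.mem_finsuppAntidiag'.1 h).2), mul_zero]
    have hh : HasSum G (t ^ n * Q n) := by
      have h1 : HasSum G (∑ α ∈ Finset.finsuppAntidiag S n, G α) :=
        hasSum_sum_of_ne_finset_zero hG0
      have h2 : ∑ α ∈ Finset.finsuppAntidiag S n, G α = t ^ n * Q n := by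
        rw [Finset.mul_sum]
        exact Finset.sum_congr rfl hG1
      rwa [h2] at h1
    have hh' : HasSum (fun p : {α : ℕ →₀ ℕ // (α.sum fun _ x => x) = n} => G p.1)
        (t ^ n * Q n) := by
      refine (Function.Injective.hasSum_iff (f := G) Subtype.val_injective fun α hα => ?_).2 hh
      exact hG0 α fun h => hα ⟨⟨α, (Finset.mem_finsuppAntidiag'.1 h).1⟩, rfl⟩
    have hG := funext hval
    rw [← hG] at hh'
    exact hh'
  let p : FormalMultilinearSeries ℂ ℂ ℂ :=
    fun n => ContinuousMultilinearMap.mkPiRing ℂ (Fin n) (Q n)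
  have hp : ∀ n, p.coeff n = Q n := fun n => by
    simp [p, FormalMultilinearSeries.coeff]
  have hps : HasFPowerSeriesAt (fun _ : ℂ => (0 : ℂ)) p 0 := by
    refine hasFPowerSeriesAt_iff.2 ?_
    have : ∀ᶠ t in nhds (0 : ℂ), ‖t‖ < 1 / M := by
      have := Metric.ball_mem_nhds (0 : ℂ) (show 0 < 1 / M by positivity)
      filter_upwards [this] with t ht
      simpa using ht
    filter_upwards [this] with t ht
    simpa only [hp, smul_eq_mul] using hQ t ht
  have hQ0 : Q n₀ = 0 := by
    rw [← hp, hps.eq_zero]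
    rfl
  rw [hP, map_sum, ← hQ0]
  refine Finset.sum_congr rfl fun α _ => ?_
  rw [MvPolynomial.eval_monomial]

/-- The Wiener algebra `A⁺(𝕋^∞)`, with pointwise operations: the functions
`f(z) = ∑_α a_α z^α` with `∑_α |a_α| < ∞`, regarded as functions on `𝐁`. -/
def wienerPlus : Subalgebra ℂ (ballB → ℂ) where
  carrier := {f | ∃ a, IsExpansion a f}
  mul_mem' := by
    rintro f g ⟨a, ha⟩ ⟨b, hb⟩
    exact ⟨_, ha.mul hb⟩
  add_mem' := by
    rintro f g ⟨a, ha⟩ ⟨b, hb⟩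
    exact ⟨_, ha.add hb⟩
  algebraMap_mem' := fun c => ⟨_, IsExpansion.const c⟩

/-- The coefficients `a_α` of `f ∈ A⁺(𝕋^∞)`. -/
def wienerCoeff (f : wienerPlus) : (ℕ →₀ ℕ) → ℂ := Classical.choose f.2

theorem wienerCoeff_spec (f : wienerPlus) : IsExpansion (wienerCoeff f) f.1 :=
  Classical.choose_spec f.2

/-- The norm `‖f‖ = ∑_α |a_α|` of `A⁺(𝕋^∞)`. -/
def wienerNorm (f : wienerPlus) : ℝ := ∑' α, ‖wienerCoeff f α‖

theorem wienerNorm_eq {f : wienerPlus} {a : (ℕ →₀ ℕ) → ℂ} (ha : IsExpansion a f.1) :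
    wienerNorm f = ∑' α, ‖a α‖ := by
  rw [wienerNorm, (wienerCoeff_spec f).unique ha]

/-- Analyticity of a map `φ : 𝐁 → 𝐁`, as a map on an open subset of the Banach space `c₀` with
values in `c₀` (the extension `F` only serves to give `φ` values off `𝐁`). -/
def IsAnalyticSelfMap (φ : ballB → ballB) : Prop :=
  ∃ F : CZero → CZero, AnalyticOnNhd ℂ F ballB ∧ ∀ z : ballB, F z.1 = (φ z).1

/-- `φ` induces a composition operator on `A⁺(𝕋^∞)`: `f ∘ φ ∈ A⁺(𝕋^∞)` for all
`f ∈ A⁺(𝕋^∞)`. -/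
def InducesCompOp (φ : ballB → ballB) : Prop :=
  ∀ f ∈ wienerPlus, f ∘ φ ∈ wienerPlus

/-- The composition operator `C_φ f = f ∘ φ`, an endomorphism of the algebra `A⁺(𝕋^∞)`. -/
def compOp (φ : ballB → ballB) (h : InducesCompOp φ) : wienerPlus →ₐ[ℂ] wienerPlus where
  toFun f := ⟨f.1 ∘ φ, h f.1 f.2⟩
  map_one' := rfl
  map_mul' _ _ := rfl
  map_zero' := rfl
  map_add' _ _ := rfl
  commutes' _ := rfl

end

/-!
Identify `A⁺(𝕋^∞)` with `ℓ¹` of the multi-indices. In `ℓ¹`, the equalities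
`‖f + g‖ = ‖f‖ + ‖g‖ = ‖f - g‖` express that `f` and `g` have disjoint supports, so a surjective
linear isometry preserves disjointness and must permute the basis vectors up to unimodular factors.
An isometric automorphism of `A⁺(𝕋^∞)` thus permutes the monomials up to unimodular factors. Being
multiplicative, it acts on exponents as an automorphism of the free commutative monoid of
multi-indices, and such an automorphism permutes the free generators, as these are the irreducible
elements.
-/

section FreeCommutativeMonoid

variable {ι κ M N : Type*}

theorem addIrreducible_map [AddMonoid M] [AddMonoid N] (e : M ≃+ N) {x : M}
    (hx : AddIrreducible x) : AddIrreducible (e x) where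
  not_isAddUnit h := hx.not_isAddUnit (by simpa using h.map e.symm)
  isAddUnit_or_isAddUnit a b h := by
    have hx' : x = e.symm a + e.symm b := by rw [← map_add, ← h, e.symm_apply_apply]
    exact (hx.isAddUnit_or_isAddUnit hx').imp (fun ha => by simpa using ha.map e)
      fun hb => by simpa using hb.map e

theorem addIrreducible_single_one (i : ι) : AddIrreducible (Finsupp.single i 1 : ι →₀ ℕ) where
  not_isAddUnit := by simp
  isAddUnit_or_isAddUnit α β h := by
    have hdeg : α.degree + β.degree = 1 := by
      rw [← map_add, ← h, Finsupp.degree_single]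
    simp only [isAddUnit_iff_eq_zero, ← Finsupp.degree_eq_zero_iff]
    omega

theorem addIrreducible_iff_exists_eq_single {α : ι →₀ ℕ} :
    AddIrreducible α ↔ ∃ i, α = Finsupp.single i 1 := by
  refine ⟨fun hα => ?_, fun ⟨i, hi⟩ => hi ▸ addIrreducible_single_one i⟩
  obtain ⟨i, hi⟩ := Finsupp.support_nonempty_iff.2 hα.ne_zero
  have hle : Finsupp.single i 1 ≤ α :=
    Finsupp.single_le_iff.2 (Nat.one_le_iff_ne_zero.2 (Finsupp.mem_support_iff.1 hi))
  obtain ⟨γ, rfl⟩ := exists_add_of_le hle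
  have hγ : IsAddUnit γ :=
    (hα.isAddUnit_or_isAddUnit rfl).resolve_left (addIrreducible_single_one i).not_isAddUnit
  exact ⟨i, by rw [isAddUnit_iff_eq_zero.1 hγ, add_zero]⟩

theorem exists_equiv_map_finsupp_single_one (e : (ι →₀ ℕ) ≃+ (κ →₀ ℕ)) :
    ∃ σ : ι ≃ κ, ∀ i, e (Finsupp.single i 1) = Finsupp.single (σ i) 1 := by
  choose s hs using fun i => addIrreducible_iff_exists_eq_single.1
    (addIrreducible_map e (addIrreducible_single_one i))
  choose t ht using fun k => addIrreducible_iff_exists_eq_single.1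
    (addIrreducible_map e.symm (addIrreducible_single_one k))
  refine ⟨⟨s, t, fun i => ?_, fun k => ?_⟩, hs⟩
  · rw [← Finsupp.single_left_inj (one_ne_zero (α := ℕ)), ← ht, ← hs, e.symm_apply_apply]
  · rw [← Finsupp.single_left_inj (one_ne_zero (α := ℕ)), ← hs, ← ht, e.apply_symm_apply]

end FreeCommutativeMonoid

section EllOne

open scoped lp

variable {ι κ : Type*} {E : ι → Type*} [∀ i, NormedAddCommGroup (E i)]
  {F : κ → Type*} [∀ k, NormedAddCommGroup (F k)]

theorem memℓp_one_iff_summable {a : ∀ i, E i} : Memℓp a 1 ↔ Summable fun i => ‖a i‖ := by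
  simpa using memℓp_gen_iff (f := a) (p := 1) (by simp)

theorem hasSum_norm_lp_one (f : lp E 1) : HasSum (fun i => ‖f i‖) ‖f‖ := by
  simpa using lp.hasSum_norm (by simp) f

theorem norm_add_lp_one_eq_iff {f g : lp E 1} :
    ‖f + g‖ = ‖f‖ + ‖g‖ ↔ ∀ i, ‖f i + g i‖ = ‖f i‖ + ‖g i‖ := by
  have hgap : HasSum (fun i => ‖f i‖ + ‖g i‖ - ‖f i + g i‖) (‖f‖ + ‖g‖ - ‖f + g‖) :=
    ((hasSum_norm_lp_one f).add (hasSum_norm_lp_one g)).sub (hasSum_norm_lp_one (f + g))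
  have hgap_nonneg : 0 ≤ fun i => ‖f i‖ + ‖g i‖ - ‖f i + g i‖ :=
    fun i => sub_nonneg.2 (norm_add_le _ _)
  rw [eq_comm, ← sub_eq_zero]
  constructor
  · intro h i
    rw [h, hasSum_zero_iff_of_nonneg hgap_nonneg] at hgap
    exact (sub_eq_zero.1 (congrFun hgap i)).symm
  · intro h
    exact hgap.unique (by simp [h])

theorem norm_sub_lp_one_eq_iff {f g : lp E 1} :
    ‖f - g‖ = ‖f‖ + ‖g‖ ↔ ∀ i, ‖f i - g i‖ = ‖f i‖ + ‖g i‖ := by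
  simpa [← sub_eq_add_neg] using norm_add_lp_one_eq_iff (f := f) (g := -g)

theorem eq_zero_or_eq_zero_of_norm_add_of_norm_sub {V : Type*} [NormedAddCommGroup V]
    [NormedSpace ℝ V] [StrictConvexSpace ℝ V] {x y : V} (hadd : ‖x + y‖ = ‖x‖ + ‖y‖)
    (hsub : ‖x - y‖ = ‖x‖ + ‖y‖) : x = 0 ∨ y = 0 := by
  by_contra! h
  have hy : SameRay ℝ x y := sameRay_iff_norm_add.2 hadd
  have hy' : SameRay ℝ x (-y) := sameRay_iff_norm_add.2 (by rwa [norm_neg, ← sub_eq_add_neg])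
  exact h.2 (eq_zero_of_sameRay_self_neg (hy.symm.trans hy' fun hx => absurd hx h.1))

theorem norm_add_lp_one_of_disjoint {f g : lp E 1} (h : ∀ i, f i = 0 ∨ g i = 0) :
    ‖f + g‖ = ‖f‖ + ‖g‖ :=
  norm_add_lp_one_eq_iff.2 fun i => by rcases h i with h | h <;> simp [h]

theorem norm_sub_lp_one_of_disjoint {f g : lp E 1} (h : ∀ i, f i = 0 ∨ g i = 0) :
    ‖f - g‖ = ‖f‖ + ‖g‖ :=
  norm_sub_lp_one_eq_iff.2 fun i => by rcases h i with h | h <;> simp [h]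

theorem disjoint_of_norm_add_of_norm_sub_lp_one [∀ i, NormedSpace ℝ (E i)]
    [∀ i, StrictConvexSpace ℝ (E i)] {f g : lp E 1} (hadd : ‖f + g‖ = ‖f‖ + ‖g‖)
    (hsub : ‖f - g‖ = ‖f‖ + ‖g‖) (i : ι) : f i = 0 ∨ g i = 0 :=
  eq_zero_or_eq_zero_of_norm_add_of_norm_sub (norm_add_lp_one_eq_iff.1 hadd i)
    (norm_sub_lp_one_eq_iff.1 hsub i)

theorem disjoint_map_lp_one [∀ k, NormedSpace ℝ (F k)] [∀ k, StrictConvexSpace ℝ (F k)]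
    {𝓕 : Type*} [FunLike 𝓕 (lp E 1) (lp F 1)] [AddMonoidHomClass 𝓕 (lp E 1) (lp F 1)] {U : 𝓕}
    (hU : ∀ f, ‖U f‖ = ‖f‖) {f g : lp E 1} (h : ∀ i, f i = 0 ∨ g i = 0) (k : κ) :
    U f k = 0 ∨ U g k = 0 :=
  disjoint_of_norm_add_of_norm_sub_lp_one
    (by rw [← map_add, hU, hU, hU, norm_add_lp_one_of_disjoint h])
    (by rw [← map_sub, hU, hU, hU, norm_sub_lp_one_of_disjoint h]) k

variable {𝕜 : Type*} [RCLike 𝕜]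

variable [DecidableEq ι]

theorem disjoint_single_one_iff {f : ℓ¹(ι, 𝕜)} {i : ι} :
    (∀ j, f j = 0 ∨ (lp.single 1 i 1 : ℓ¹(ι, 𝕜)) j = 0) ↔ f i = 0 := by
  refine ⟨fun h => (h i).resolve_right (by simp), fun h j => ?_⟩
  rcases eq_or_ne j i with rfl | hj
  · exact .inl h
  · exact .inr (lp.single_apply_ne 1 i 1 hj)

theorem eq_of_map_single_one_apply_ne_zero (U : ℓ¹(ι, 𝕜) ≃ₗᵢ[𝕜] ℓ¹(κ, 𝕜)) {i : ι} {k l : κ}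
    (hk : U (lp.single 1 i 1) k ≠ 0) (hl : U (lp.single 1 i 1) l ≠ 0) : k = l := by
  classical
  by_contra hkl
  -- `U⁻¹ e_k` and `U⁻¹ e_l` are disjoint, so one of them vanishes at `i` and is thus disjoint from
  -- `e_i`; applying `U`, one of `e_k` and `e_l` is disjoint from `U e_i`.
  have apply_eq_zero : ∀ {m : κ}, U.symm (lp.single 1 m 1) i = 0 → U (lp.single 1 i 1) m = 0 := by
    intro m hm
    simpa using disjoint_map_lp_one U.norm_map (disjoint_single_one_iff.2 hm) m
  have hdisj : (lp.single 1 k 1 : ℓ¹(κ, 𝕜)) l = 0 := lp.single_apply_ne 1 k 1 (Ne.symm hkl)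
  rcases disjoint_map_lp_one U.symm.norm_map (disjoint_single_one_iff.2 hdisj) i with h | h
  · exact hk (apply_eq_zero h)
  · exact hl (apply_eq_zero h)

theorem eq_of_smul_single_one_eq {c d : 𝕜} {i j : ι} (hc : c ≠ 0)
    (h : c • (lp.single 1 i 1 : ℓ¹(ι, 𝕜)) = d • lp.single 1 j 1) : i = j := by
  by_contra hij
  have hi := congrArg (fun f : ℓ¹(ι, 𝕜) => f i) h
  simp [hij, hc] at hi

variable [DecidableEq κ]

theorem exists_map_lp_single_one (U : ℓ¹(ι, 𝕜) ≃ₗᵢ[𝕜] ℓ¹(κ, 𝕜)) (i : ι) :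
    ∃ (c : 𝕜) (k : κ), ‖c‖ = 1 ∧ U (lp.single 1 i 1) = c • lp.single 1 k 1 := by
  have hnorm : ‖U (lp.single 1 i 1)‖ = 1 := by
    rw [U.norm_map, lp.norm_single one_pos, norm_one]
  obtain ⟨k, hk⟩ : ∃ k, U (lp.single 1 i 1) k ≠ 0 := by
    by_contra! h
    rw [show U (lp.single 1 i 1) = 0 from lp.ext (funext h), norm_zero] at hnorm
    exact zero_ne_one hnorm
  have hU : U (lp.single 1 i 1) = U (lp.single 1 i 1) k • lp.single 1 k 1 := by
    ext l
    rcases eq_or_ne l k with rfl | hl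
    · simp
    · simpa [hl] using not_imp_comm.1 (fun h => eq_of_map_single_one_apply_ne_zero U h hk) hl
  refine ⟨_, k, ?_, hU⟩
  rwa [hU, norm_smul, lp.norm_single one_pos, norm_one, mul_one] at hnorm

theorem exists_equiv_map_lp_single_one (U : ℓ¹(ι, 𝕜) ≃ₗᵢ[𝕜] ℓ¹(κ, 𝕜)) :
    ∃ (e : ι ≃ κ) (c : ι → 𝕜), (∀ i, ‖c i‖ = 1) ∧
      ∀ i, U (lp.single 1 i 1) = c i • lp.single 1 (e i) 1 := by
  choose c s hc hs using exists_map_lp_single_one U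
  choose d t _ ht using exists_map_lp_single_one U.symm
  refine ⟨⟨s, t, fun i => ?_, fun k => ?_⟩, c, hc, hs⟩
  · refine (eq_of_smul_single_one_eq (d := c i * d (s i)) (one_ne_zero (α := 𝕜)) ?_).symm
    rw [one_smul, mul_smul, ← ht, ← map_smul, ← hs, U.symm_apply_apply]
  · refine (eq_of_smul_single_one_eq (d := d k * c (t k)) (one_ne_zero (α := 𝕜)) ?_).symm
    rw [one_smul, mul_smul, ← hs, ← map_smul, ← ht, U.apply_symm_apply]

end EllOne

section WienerAlgebra

open scoped lp

theorem IsExpansion.smul {a : (ℕ →₀ ℕ) → ℂ} {f : ballB → ℂ} (c : ℂ) (hf : IsExpansion a f) :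
    IsExpansion (c • a) (c • f) := by
  refine ⟨by simpa only [Pi.smul_apply, norm_smul] using hf.1.mul_left ‖c‖, fun z => ?_⟩
  simp only [Pi.smul_apply, smul_eq_mul, hf.2, mul_assoc, tsum_mul_left]

theorem isExpansion_monom (α : ℕ →₀ ℕ) : IsExpansion (Pi.single α 1) (monom α) := by
  refine ⟨summable_of_ne_finset_zero (s := {α}) fun β hβ => ?_, fun z => ?_⟩
  · rw [Pi.single_eq_of_ne (by simpa using hβ), norm_zero]
  · rw [tsum_eq_single α fun β hβ => by rw [Pi.single_eq_of_ne hβ, zero_mul], Pi.single_eq_same,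
      one_mul]

theorem wienerCoeff_eq {f : wienerPlus} {a : (ℕ →₀ ℕ) → ℂ} (ha : IsExpansion a f.1) :
    wienerCoeff f = a :=
  (wienerCoeff_spec f).unique ha

/-- The identification of `A⁺(𝕋^∞)` with `ℓ¹` of the multi-indices, through the coefficients. -/
noncomputable def wienerCoeffEquiv : wienerPlus ≃ₗ[ℂ] ℓ¹(ℕ →₀ ℕ, ℂ) where
  toFun f := ⟨wienerCoeff f, memℓp_one_iff_summable.2 (wienerCoeff_spec f).1⟩
  invFun a := ⟨fun z => ∑' α, a α * monom α z, a, memℓp_one_iff_summable.1 a.2, fun _ => rfl⟩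
  map_add' f g := Subtype.ext (wienerCoeff_eq ((wienerCoeff_spec f).add (wienerCoeff_spec g)))
  map_smul' c f := Subtype.ext (wienerCoeff_eq ((wienerCoeff_spec f).smul c))
  left_inv f := Subtype.ext (funext fun z => ((wienerCoeff_spec f).2 z).symm)
  right_inv a := Subtype.ext (wienerCoeff_eq ⟨memℓp_one_iff_summable.1 a.2, fun _ => rfl⟩)

theorem norm_wienerCoeffEquiv (f : wienerPlus) : ‖wienerCoeffEquiv f‖ = wienerNorm f :=
  (hasSum_norm_lp_one (wienerCoeffEquiv f)).tsum_eq.symm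

/-- The monomial `z^α` as an element of `A⁺(𝕋^∞)`. -/
noncomputable def wienerMonom (α : ℕ →₀ ℕ) : wienerPlus :=
  ⟨monom α, Pi.single α 1, isExpansion_monom α⟩

theorem wienerCoeffEquiv_wienerMonom (α : ℕ →₀ ℕ) :
    wienerCoeffEquiv (wienerMonom α) = lp.single 1 α 1 :=
  Subtype.ext (wienerCoeff_eq (isExpansion_monom α))

theorem wienerMonom_add (α β : ℕ →₀ ℕ) :
    wienerMonom (α + β) = wienerMonom α * wienerMonom β :=
  Subtype.ext <| funext fun _ =>
    Finsupp.prod_add_index' (fun _ => pow_zero _) fun _ _ _ => pow_add _ _ _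

theorem wienerMonom_single_one_apply (j : ℕ) (z : ballB) :
    (wienerMonom (Finsupp.single j 1)).1 z = z.1 j := by
  simp [wienerMonom, monom]

theorem eq_of_smul_wienerMonom_eq {c d : ℂ} {α β : ℕ →₀ ℕ} (hc : c ≠ 0)
    (h : c • wienerMonom α = d • wienerMonom β) : α = β := by
  refine eq_of_smul_single_one_eq (d := d) hc ?_
  simpa only [map_smul, wienerCoeffEquiv_wienerMonom] using congrArg wienerCoeffEquiv h

theorem exists_equiv_map_wienerMonom (T : wienerPlus ≃ₗ[ℂ] wienerPlus)
    (hT : ∀ f, wienerNorm (T f) = wienerNorm f) :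
    ∃ (e : (ℕ →₀ ℕ) ≃ (ℕ →₀ ℕ)) (c : (ℕ →₀ ℕ) → ℂ), (∀ α, ‖c α‖ = 1) ∧
      ∀ α, T (wienerMonom α) = c α • wienerMonom (e α) := by
  let U : ℓ¹(ℕ →₀ ℕ, ℂ) ≃ₗᵢ[ℂ] ℓ¹(ℕ →₀ ℕ, ℂ) :=
    { toLinearEquiv := wienerCoeffEquiv.symm ≪≫ₗ T ≪≫ₗ wienerCoeffEquiv
      norm_map' := fun a => by
        simp [norm_wienerCoeffEquiv, hT, ← norm_wienerCoeffEquiv (wienerCoeffEquiv.symm a)] }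
  obtain ⟨e, c, hc, hU⟩ := exists_equiv_map_lp_single_one U
  refine ⟨e, c, hc, fun α => wienerCoeffEquiv.injective ?_⟩
  calc wienerCoeffEquiv (T (wienerMonom α)) = U (wienerCoeffEquiv (wienerMonom α)) := by simp [U]
    _ = wienerCoeffEquiv (c α • wienerMonom (e α)) := by
      simp only [map_smul, wienerCoeffEquiv_wienerMonom, hU]

theorem exists_addEquiv_map_wienerMonom (T : wienerPlus ≃ₐ[ℂ] wienerPlus)
    (hT : ∀ f, wienerNorm (T f) = wienerNorm f) :
    ∃ (e : (ℕ →₀ ℕ) ≃+ (ℕ →₀ ℕ)) (c : (ℕ →₀ ℕ) → ℂ), (∀ α, ‖c α‖ = 1) ∧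
      ∀ α, T (wienerMonom α) = c α • wienerMonom (e α) := by
  obtain ⟨e, c, hc, he⟩ := exists_equiv_map_wienerMonom T.toLinearEquiv hT
  replace he : ∀ α, T (wienerMonom α) = c α • wienerMonom (e α) := he
  have hc0 : ∀ α, c α ≠ 0 := fun α => norm_ne_zero_iff.1 (by simp [hc])
  have e_add : ∀ α β, e (α + β) = e α + e β := fun α β => by
    refine eq_of_smul_wienerMonom_eq (d := c α * c β) (hc0 (α + β)) ?_
    calc c (α + β) • wienerMonom (e (α + β)) = T (wienerMonom α * wienerMonom β) := by
          rw [← wienerMonom_add, ← he]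
      _ = c α • wienerMonom (e α) * c β • wienerMonom (e β) := by rw [map_mul, he, he]
      _ = (c α * c β) • wienerMonom (e α + e β) := by
          rw [smul_mul_smul_comm, wienerMonom_add]
  exact ⟨{ e with map_add' := e_add }, c, hc, he⟩

theorem compOp_apply (φ : ballB → ballB) (h : InducesCompOp φ) (f : wienerPlus) (z : ballB) :
    (compOp φ h f).1 z = f.1 (φ z) :=
  rfl

theorem theorem4p5_general (T : wienerPlus ≃ₐ[ℂ] wienerPlus)
    (hT : ∀ f, wienerNorm (T f) = wienerNorm f) :
    ∃ (σ : Equiv.Perm ℕ) (ε : ℕ → ℂ), (∀ j, ‖ε j‖ = 1) ∧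
      ∀ j, T (wienerMonom (Finsupp.single j 1)) =
        ε j • wienerMonom (Finsupp.single (σ j) 1) := by
  obtain ⟨e, c, hc, he⟩ := exists_addEquiv_map_wienerMonom T hT
  obtain ⟨σ, hσ⟩ := exists_equiv_map_finsupp_single_one e
  refine ⟨σ, fun j => c (Finsupp.single j 1), fun j => hc _, fun j => ?_⟩
  rw [he, hσ]

end WienerAlgebra

theorem theorem4p5 (φ : ballB → ballB) (hφ : IsAnalyticSelfMap φ) (hC : InducesCompOp φ)
    (haut : Function.Bijective (compOp φ hC))
    (hiso : ∀ f : wienerPlus, wienerNorm (compOp φ hC f) = wienerNorm f) :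
    ∃ (σ : Equiv.Perm ℕ) (ε : ℕ → ℂ), (∀ j, ‖ε j‖ = 1) ∧
      ∀ (z : ballB) (j : ℕ), (φ z).1 j = ε j * z.1 (σ j) := by
  obtain ⟨σ, ε, hε, h⟩ := theorem4p5_general (AlgEquiv.ofBijective (compOp φ hC) haut) hiso
  exact ⟨σ, ε, hε, fun z j => by
    simpa [compOp_apply, wienerMonom_single_one_apply] using
      congrArg (fun f : wienerPlus => f.1 z) (h j)⟩
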